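/- Let $A$ be an associative ring with $1$, let $J$ be its Jacobson radical, and suppose that $A$ is semiprimary (that is, $A/J$ is semisimple and $J$ is nilpotent) and left self-injective (that is, $A$ is injective as a left $A$-module). Write $|X|$ for the cardinality of a set $X$. (1) If $|A/J|\le\aleph_0$, then $A$ is quasi-Frobenius (QF). (2) If $|A/J|<|A|$, then $A$ is quasi-Frobenius (QF). Here a ring is called quasi-Frobenius if it is left and right artinian and left and right self-injective. -/

import Mathlib

/-- A ring `A` is left self-injective if it is injective as a left module over itself. -/
def IsLeftSelfInjective (A : Type*) [Ring A] : Prop :=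
  Module.Injective A A

/-- A ring `A` is right self-injective if it is injective as a right module over itself; right
`A`-modules are modules over the opposite ring `Aᵐᵒᵖ`, which acts on `A` by right
multiplication. -/
def IsRightSelfInjective (A : Type*) [Ring A] : Prop :=
  Module.Injective Aᵐᵒᵖ A

/-- A ring is quasi-Frobenius (QF) if it is artinian and self-injective, on both sides. -/
structure IsQuasiFrobenius (A : Type*) [Ring A] : Prop where
  left_artinian : IsArtinian A A
  right_artinian : IsArtinian Aᵐᵒᵖ A
  left_selfInjective : IsLeftSelfInjective A
  right_selfInjective : IsRightSelfInjective A

/-!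
Write `J` for the Jacobson radical and `S` for the right annihilator of `J`. Left self-injectivity
makes a right ideal `R` a right annihilator as soon as `A ⧸ leftAnnihilator R` is artinian, in
particular if `R ≤ S`. Hence `I ↦ leftAnnihilator (S * I)` is an injective self-map of the set of
two-sided ideals containing `J`. This set is finite, so `J` is a value of the map, which forces
`leftAnnihilator S = J`. It follows that every simple left module embeds in `A`, so that `A`, being
injective, cogenerates its left modules.

A module that contains a direct sum of `κ` nonzero submodules therefore has at least `2 ^ κ`
linear functionals, whereas `A` has only `#A`. Going through the radical filtration, this bounds
the number of simple constituents of each layer and gives `#A ≤ max ℵ₀ #(A ⧸ J)`; if `A` is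
countable, the layers even have finite length. So in both parts of the theorem `A` is countable
and left artinian. Now left and right annihilators are mutually inverse between left and right
ideals, which makes `A` right noetherian and right artinian, and the Ikeda–Nakayama gluing of left
multiplications along `leftAnnihilator (R ⊓ R') = leftAnnihilator R ⊔ leftAnnihilator R'` gives
right self-injectivity.
-/

universe u v

open Cardinal Pointwise

section InjectiveModules

variable {R M N : Type*} [Ring R] [AddCommGroup M] [Module R M] [AddCommGroup N] [Module R N]
  {Q : Type v} [AddCommGroup Q] [Module R Q] [Small.{v} R] [Module.Injective R Q]

theorem exists_comp_eq_of_ker_le (f : M →ₗ[R] N) (g : M →ₗ[R] Q)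
    (h : LinearMap.ker f ≤ LinearMap.ker g) : ∃ k : N →ₗ[R] Q, k ∘ₗ f = g := by
  obtain ⟨k, hk⟩ := Module.Injective.extension_property R Q _ N ((LinearMap.ker f).liftQ f le_rfl)
    (LinearMap.ker_eq_bot.mp (Submodule.ker_liftQ_eq_bot _ _ _ le_rfl))
    ((LinearMap.ker f).liftQ g h)
  refine ⟨k, ?_⟩
  rw [← (LinearMap.ker f).liftQ_mkQ f le_rfl, ← LinearMap.comp_assoc, hk, Submodule.liftQ_mkQ]

theorem exists_linearMap_forall_apply_eq_of_iSupIndep {ι : Type*} {N : ι → Submodule R M}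
    (hN : iSupIndep N) (φ : ∀ i, N i →ₗ[R] Q) : ∃ k : M →ₗ[R] Q, ∀ i (x : N i), k x = φ i x := by
  classical
  obtain ⟨k, hk⟩ := Module.Injective.extension_property R Q _ M
    (DFinsupp.lsum ℕ fun i ↦ (N i).subtype) hN.dfinsupp_lsum_injective (DFinsupp.lsum ℕ φ)
  exact ⟨k, fun i x ↦ by simpa using LinearMap.congr_fun hk (DFinsupp.single i x)⟩

theorem exists_linearMap_apply_ne_zero_of_forall_isMaximal
    (hQ : ∀ I : Ideal R, I.IsMaximal → ∃ y : Q, y ≠ 0 ∧ ∀ a ∈ I, a • y = 0)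
    {x : N} (hx : x ≠ 0) : ∃ f : N →ₗ[R] Q, f x ≠ 0 := by
  have hne : LinearMap.ker (LinearMap.toSpanSingleton R N x) ≠ ⊤ := fun h ↦ hx <| by
    simpa using (Ideal.eq_top_iff_one _).mp h
  obtain ⟨I, hI, hle⟩ := Ideal.exists_le_maximal _ hne
  obtain ⟨y, hy, hIy⟩ := hQ I hI
  obtain ⟨f, hf⟩ := exists_comp_eq_of_ker_le (LinearMap.toSpanSingleton R N x)
    (LinearMap.toSpanSingleton R Q y) fun a ha ↦ hIy a (hle ha)
  have hfx : f x = y := by simpa using LinearMap.congr_fun hf 1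
  exact ⟨f, hfx ▸ hy⟩

end InjectiveModules

section Annihilators

variable {A : Type*} [Ring A]

/-- The left annihilator `{a | a * x = 0 for all x ∈ X}` of a set `X`, a left ideal. -/
def leftAnnihilator (X : Set A) : Ideal A :=
  (⊥ : Ideal A).colon X

/-- The right annihilator `{a | x * a = 0 for all x ∈ X}` of a set `X`, a right ideal; right ideals
are encoded as `Aᵐᵒᵖ`-submodules of `A`. -/
def rightAnnihilator (X : Set A) : Submodule Aᵐᵒᵖ A where
  carrier := {a | ∀ x ∈ X, x * a = 0}
  add_mem' ha hb x hx := by rw [mul_add, ha x hx, hb x hx, add_zero]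
  zero_mem' x _ := mul_zero x
  smul_mem' c a ha x hx := by rw [mul_smul_comm, ha x hx, smul_zero]

theorem mem_leftAnnihilator {X : Set A} {a : A} : a ∈ leftAnnihilator X ↔ ∀ x ∈ X, a * x = 0 :=
  Submodule.mem_colon

theorem mem_rightAnnihilator {X : Set A} {a : A} : a ∈ rightAnnihilator X ↔ ∀ x ∈ X, x * a = 0 :=
  Iff.rfl

theorem leftAnnihilator_anti {X Y : Set A} (h : X ⊆ Y) : leftAnnihilator Y ≤ leftAnnihilator X :=
  Submodule.colon_mono le_rfl h

theorem le_rightAnnihilator_leftAnnihilator (R : Submodule Aᵐᵒᵖ A) :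
    R ≤ rightAnnihilator (leftAnnihilator (R : Set A) : Set A) :=
  fun _ hx _ ha ↦ mem_leftAnnihilator.mp ha _ hx

theorem mul_mem_of_mem_rightIdeal {R : Submodule Aᵐᵒᵖ A} {x : A} (hx : x ∈ R) (a : A) :
    x * a ∈ R :=
  R.smul_mem (MulOpposite.op a) hx

theorem leftAnnihilator_span (X : Set A) :
    leftAnnihilator (Submodule.span Aᵐᵒᵖ X : Set A) = leftAnnihilator X := by
  refine le_antisymm (leftAnnihilator_anti Submodule.subset_span) fun a ha ↦ ?_
  have hX : Submodule.span Aᵐᵒᵖ X ≤ rightAnnihilator {a} :=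
    Submodule.span_le.mpr fun x hx b hb ↦ hb ▸ mem_leftAnnihilator.mp ha x hx
  exact mem_leftAnnihilator.mpr fun x hx ↦ hX hx a rfl

theorem rightAnnihilator_sup (I J : Ideal A) :
    rightAnnihilator ((I ⊔ J : Ideal A) : Set A) =
      rightAnnihilator (I : Set A) ⊓ rightAnnihilator (J : Set A) := by
  ext y
  simp only [Submodule.mem_inf, mem_rightAnnihilator, SetLike.mem_coe]
  refine ⟨fun h ↦ ⟨fun a ha ↦ h a (Ideal.mem_sup_left ha), fun a ha ↦ h a (Ideal.mem_sup_right ha)⟩,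
    fun ⟨hI, hJ⟩ a ha ↦ ?_⟩
  obtain ⟨b, hb, c, hc, rfl⟩ := Submodule.mem_sup.mp ha
  rw [add_mul, hI b hb, hJ c hc, add_zero]

theorem mul_mem_rightAnnihilator {I : Ideal A} [I.IsTwoSided] {x : A}
    (hx : x ∈ rightAnnihilator (I : Set A)) (a : A) : a * x ∈ rightAnnihilator (I : Set A) :=
  fun i hi ↦ by rw [← mul_assoc, hx _ (I.mul_mem_right a hi)]

theorem leftAnnihilator_isTwoSided {X : Set A} (hX : ∀ a, ∀ x ∈ X, a * x ∈ X) :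
    (leftAnnihilator X).IsTwoSided :=
  ⟨fun {a} b ha ↦ mem_leftAnnihilator.mpr fun x hx ↦ by
    rw [mul_assoc, mem_leftAnnihilator.mp ha _ (hX b x hx)]⟩

theorem exists_fg_le_leftAnnihilator_eq (R : Submodule Aᵐᵒᵖ A)
    [IsArtinian A (A ⧸ leftAnnihilator (R : Set A))] :
    ∃ R₀ ≤ R, R₀.FG ∧ leftAnnihilator (R₀ : Set A) = leftAnnihilator (R : Set A) := by
  have : WellFoundedLT (Set.Ici (leftAnnihilator (R : Set A))) :=
    (Submodule.comapMkQRelIso _).symm.toOrderEmbedding.wellFoundedLT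
  let ann (R₀ : Set.Iic R) : Set.Ici (leftAnnihilator (R : Set A)) :=
    ⟨leftAnnihilator (R₀.1 : Set A), leftAnnihilator_anti R₀.2⟩
  obtain ⟨⟨R₀, hR₀⟩, hfg, hmin⟩ :=
    exists_minimalFor_of_wellFoundedLT (fun R₀ : Set.Iic R ↦ R₀.1.FG) ann ⟨⊥, Submodule.fg_bot⟩
  refine ⟨R₀, hR₀, hfg, le_antisymm (fun a ha ↦ mem_leftAnnihilator.mpr fun r hr ↦ ?_)
    (leftAnnihilator_anti hR₀)⟩
  let R₁ : Set.Iic R := ⟨R₀ ⊔ Submodule.span Aᵐᵒᵖ {r},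
    sup_le hR₀ ((Submodule.span_singleton_le_iff_mem r R).mpr hr)⟩
  have hle : leftAnnihilator (R₀ : Set A) ≤ leftAnnihilator (R₁.1 : Set A) :=
    hmin (j := R₁) (hfg.sup (Submodule.fg_span_singleton r))
      (leftAnnihilator_anti (le_sup_left : R₀ ≤ R₁.1))
  exact mem_leftAnnihilator.mp (hle ha) r
    (Submodule.mem_sup_right (Submodule.mem_span_singleton_self r))

namespace IsLeftSelfInjective

theorem rightAnnihilator_leftAnnihilator_of_fg (hA : IsLeftSelfInjective A)
    {R : Submodule Aᵐᵒᵖ A} (hR : R.FG) :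
    rightAnnihilator (leftAnnihilator (R : Set A) : Set A) = R := by
  classical
  refine le_antisymm (fun x hx ↦ ?_) (le_rightAnnihilator_leftAnnihilator R)
  obtain ⟨F, rfl⟩ := hR
  have : Module.Injective A A := hA
  -- Extend `(a * y)_{y ∈ F} ↦ a * x` to a functional on `F → A`; its matrix entries express `x`.
  obtain ⟨k, hk⟩ := exists_comp_eq_of_ker_le
    (LinearMap.pi fun y : F ↦ LinearMap.toSpanSingleton A A y.1)
    (LinearMap.toSpanSingleton A A x) fun a ha ↦ hx a <| by
      rw [leftAnnihilator_span, SetLike.mem_coe, mem_leftAnnihilator]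
      exact fun y hy ↦ congrFun (LinearMap.mem_ker.mp ha) ⟨y, hy⟩
  have hx : k (fun y ↦ 1 * y.1) = x := (LinearMap.congr_fun hk 1).trans (one_mul x)
  rw [← hx, LinearMap.pi_apply_eq_sum_univ k]
  exact Submodule.sum_mem _ fun y _ ↦
    mul_mem_of_mem_rightIdeal (by simpa using Submodule.subset_span y.2) _

theorem rightAnnihilator_leftAnnihilator (hA : IsLeftSelfInjective A) (R : Submodule Aᵐᵒᵖ A)
    [IsArtinian A (A ⧸ leftAnnihilator (R : Set A))] :
    rightAnnihilator (leftAnnihilator (R : Set A) : Set A) = R := by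
  obtain ⟨R₀, hle, hfg, heq⟩ := exists_fg_le_leftAnnihilator_eq R
  refine le_antisymm ?_ (le_rightAnnihilator_leftAnnihilator R)
  rwa [← heq, hA.rightAnnihilator_leftAnnihilator_of_fg hfg]

theorem dvd_of_leftAnnihilator_le (hA : IsLeftSelfInjective A) {x y : A}
    (h : leftAnnihilator {x} ≤ leftAnnihilator {y}) : x ∣ y := by
  have hy : y ∈ Submodule.span Aᵐᵒᵖ {x} := by
    rw [← hA.rightAnnihilator_leftAnnihilator_of_fg (Submodule.fg_span_singleton x),
      leftAnnihilator_span]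
    exact fun a ha ↦ mem_leftAnnihilator.mp (h ha) y rfl
  obtain ⟨c, rfl⟩ := Submodule.mem_span_singleton.mp hy
  exact ⟨c.unop, rfl⟩

end IsLeftSelfInjective

end Annihilators

section Quotient

variable {A : Type*} [Ring A]

theorem exists_mem_forall_sub_mul_mem (J : Ideal A) [J.IsTwoSided] [IsSemisimpleRing (A ⧸ J)]
    (I : Ideal A) : ∃ e ∈ I, ∀ m ∈ I, m - m * e ∈ J := by
  obtain ⟨e', he', hspan⟩ := IsSemisimpleRing.ideal_eq_span_idempotent
    (I.map (Ideal.Quotient.mk J))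
  obtain ⟨e, heI, rfl⟩ := (Ideal.mem_map_iff_of_surjective _ Ideal.Quotient.mk_surjective).mp
    (hspan ▸ Ideal.mem_span_singleton_self e')
  refine ⟨e, heI, fun m hm ↦ ?_⟩
  have hm' := Ideal.mem_map_of_mem (Ideal.Quotient.mk J) hm
  rw [hspan] at hm'
  obtain ⟨b, hb⟩ := Ideal.mem_span_singleton'.mp hm'
  rw [← Ideal.Quotient.eq_zero_iff_mem, map_sub, map_mul, ← hb, mul_assoc, he'.eq, sub_self]

theorem finite_setOf_isTwoSided [IsSemisimpleRing A] : {I : Ideal A | I.IsTwoSided}.Finite := by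
  have : Finite (fullyInvariantSubmodule A A) :=
    Finite.of_equiv _ (OrderIso.setIsotypicComponents (R := A) (M := A)).toEquiv
  exact (Set.toFinite (fullyInvariantSubmodule A A : Set (Ideal A))).subset
    fun I hI ↦ isFullyInvariant_iff_isTwoSided.mpr hI

theorem isTwoSided_map_quotientMk {J I : Ideal A} [J.IsTwoSided] (hI : I.IsTwoSided) :
    (I.map (Ideal.Quotient.mk J)).IsTwoSided where
  mul_mem_of_left {a} b ha := by
    obtain ⟨a, haI, rfl⟩ := (Ideal.mem_map_iff_of_surjective _ Ideal.Quotient.mk_surjective).mp ha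
    obtain ⟨b, rfl⟩ := Ideal.Quotient.mk_surjective b
    rw [← map_mul]
    exact Ideal.mem_map_of_mem _ (I.mul_mem_right b haI)

theorem finite_setOf_isTwoSided_and_le (J : Ideal A) [J.IsTwoSided] [IsSemisimpleRing (A ⧸ J)] :
    {I : Ideal A | I.IsTwoSided ∧ J ≤ I}.Finite := by
  refine Set.Finite.of_finite_image (f := Ideal.map (Ideal.Quotient.mk J))
    (finite_setOf_isTwoSided.subset ?_) fun I hI I' hI' h ↦ ?_
  · rintro _ ⟨I, hI, rfl⟩
    exact isTwoSided_map_quotientMk hI.1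
  · have comap_map : ∀ K : Ideal A, J ≤ K →
        (K.map (Ideal.Quotient.mk J)).comap (Ideal.Quotient.mk J) = K := fun K hK ↦ by
      rw [Ideal.comap_map_of_surjective _ Ideal.Quotient.mk_surjective, ← RingHom.ker_eq_comap_bot,
        Ideal.mk_ker, sup_eq_left.mpr hK]
    rw [← comap_map I hI.2, ← comap_map I' hI'.2, h]

theorem isArtinian_quotient_of_isSemisimpleRing (J : Ideal A) [J.IsTwoSided]
    [IsSemisimpleRing (A ⧸ J)] : IsArtinian A (A ⧸ J) := by
  let f : (A ⧸ J) →ₛₗ[Ideal.Quotient.mk J] (A ⧸ J) := ⟨.id _, fun _ _ ↦ rfl⟩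
  exact (f.isArtinian_iff_of_bijective Function.bijective_id).mpr inferInstance

theorem exists_smul_ne_zero_and_forall_smul_eq_zero {M : Type*} [AddCommGroup M] [Module A M]
    {I : Ideal A} [I.IsTwoSided] (hI : IsNilpotent I) {x : M} (hx : x ≠ 0) :
    ∃ c : A, c • x ≠ 0 ∧ ∀ i ∈ I, i • c • x = 0 := by
  classical
  have hex : ∃ n, ∀ i ∈ I ^ n, i • x = 0 := by
    obtain ⟨n, hn⟩ := hI
    refine ⟨n, fun i hi ↦ ?_⟩
    rw [hn] at hi
    rw [(Submodule.mem_bot A).mp hi, zero_smul]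
  have hspec := Nat.find_spec hex
  cases hn : Nat.find hex with
  | zero =>
    rw [hn, Submodule.pow_zero] at hspec
    exact absurd (by simpa using hspec 1 (by simp)) hx
  | succ n =>
    have hmin := Nat.find_min hex (m := n) (by lia)
    push Not at hmin
    obtain ⟨c, hc, hcx⟩ := hmin
    refine ⟨c, hcx, fun i hi ↦ ?_⟩
    rw [hn, Ideal.IsTwoSided.pow_succ] at hspec
    rw [← mul_smul, hspec _ (Ideal.mul_mem_mul hi hc)]

end Quotient

section LeftSocle

/-- The left socle of a ring `A`, described as the right annihilator of the Jacobson radical; the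
two notions agree when `A` is semiprimary. -/
def leftSocle (A : Type*) [Ring A] : Submodule Aᵐᵒᵖ A :=
  rightAnnihilator (Ring.jacobson A : Set A)

variable {A : Type*} [Ring A]

theorem jacobson_le_leftAnnihilator_of_subset {X : Set A} (hX : X ⊆ leftSocle A) :
    Ring.jacobson A ≤ leftAnnihilator X :=
  fun j hj ↦ mem_leftAnnihilator.mpr fun _ hx ↦ hX hx j hj

theorem leftSocle_mul_subset (X : Set A) : (leftSocle A : Set A) * X ⊆ leftSocle A :=
  Set.mul_subset_iff.mpr fun _ hs a _ ↦ mul_mem_of_mem_rightIdeal hs a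

variable [IsSemiprimaryRing A]

theorem exists_mul_ne_zero_and_mul_mem_leftSocle {x : A} (hx : x ≠ 0) :
    ∃ c, c * x ≠ 0 ∧ c * x ∈ leftSocle A :=
  exists_smul_ne_zero_and_forall_smul_eq_zero IsSemiprimaryRing.isNilpotent hx

theorem eq_zero_of_mul_mul_eq_self {x j a : A} (hj : j ∈ Ring.jacobson A) (h : x * j * a = x) :
    x = 0 := by
  obtain ⟨n, hn⟩ := IsSemiprimaryRing.isNilpotent (R := A)
  have hja : IsNilpotent (j * a) :=
    ⟨n, by simpa [hn] using Ideal.pow_mem_pow (Ideal.mul_mem_right a _ hj) n⟩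
  rw [← hja.isUnit_one_sub.mul_left_eq_zero, mul_sub, mul_one, ← mul_assoc, h, sub_self]

namespace IsLeftSelfInjective

theorem exists_mul_eq_one_of_leftSocle_mul_eq_zero (hA : IsLeftSelfInjective A) {a : A}
    (ha : ∀ s ∈ leftSocle A, s * a = 0) : ∃ v, (1 + a) * v = 1 := by
  obtain ⟨v, hv⟩ := hA.dvd_of_leftAnnihilator_le (x := 1 + a) (y := 1) fun c hc ↦ by
    replace hc : c * (1 + a) = 0 := mem_leftAnnihilator.mp hc _ rfl
    suffices c = 0 from this ▸ zero_mem _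
    by_contra h0
    obtain ⟨d, hd, hdS⟩ := exists_mul_ne_zero_and_mul_mem_leftSocle h0
    apply hd
    calc d * c = d * c * (1 + a) := by rw [mul_add, ha _ hdS, mul_one, add_zero]
      _ = 0 := by rw [mul_assoc, hc, mul_zero]
  exact ⟨v, hv.symm⟩

theorem isUnit_one_add_of_leftSocle_mul_eq_zero (hA : IsLeftSelfInjective A) {a : A}
    (ha : ∀ s ∈ leftSocle A, s * a = 0) : IsUnit (1 + a) := by
  obtain ⟨v, hv⟩ := hA.exists_mul_eq_one_of_leftSocle_mul_eq_zero ha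
  have hv_eq : 1 + -(a * v) = v := by rw [← hv]; noncomm_ring
  obtain ⟨w, hw⟩ := hA.exists_mul_eq_one_of_leftSocle_mul_eq_zero (a := -(a * v))
    fun s hs ↦ by rw [mul_neg, ← mul_assoc, ha s hs, zero_mul, neg_zero]
  rw [hv_eq] at hw
  exact isUnit_iff_exists.mpr ⟨v, hv, by rwa [left_inv_eq_right_inv hv hw]⟩

theorem mem_jacobson_of_leftSocle_mul_eq_zero (hA : IsLeftSelfInjective A) {a : A}
    (ha : ∀ s ∈ leftSocle A, s * a = 0) : a ∈ Ring.jacobson A := by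
  rw [← Ideal.jacobson_bot, Ideal.mem_jacobson_iff]
  intro y
  obtain ⟨z, -, hz⟩ := isUnit_iff_exists.mp <|
    hA.isUnit_one_add_of_leftSocle_mul_eq_zero (a := y * a) fun s hs ↦ by
      rw [← mul_assoc, ha _ (mul_mem_of_mem_rightIdeal hs y)]
  refine ⟨z, ?_⟩
  rw [Submodule.mem_bot, sub_eq_zero, ← hz]
  noncomm_ring

theorem leftSocle_mul_jacobson (hA : IsLeftSelfInjective A) {s j : A} (hs : s ∈ leftSocle A)
    (hj : j ∈ Ring.jacobson A) : s * j = 0 := by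
  obtain ⟨e, he, hmod⟩ :=
    exists_mem_forall_sub_mul_mem (Ring.jacobson A) (leftAnnihilator {s * j})
  -- Replacing `s` by `s - e * s` does not change `s * j`, but turns `s` into a right multiple of
  -- `s * j`, hence into `0` because `J` is nilpotent.
  have hesj : e * (s * j) = 0 := mem_leftAnnihilator.mp he _ rfl
  have hj_eq : (s - e * s) * j = s * j := by rw [sub_mul, mul_assoc e, hesj, sub_zero]
  obtain ⟨c, hc⟩ : (s - e * s) * j ∣ s - e * s := hA.dvd_of_leftAnnihilator_le fun a ha ↦ by
    rw [hj_eq] at ha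
    have has : (a - a * e) * s = 0 := hs _ (hmod a ha)
    rw [mem_leftAnnihilator]
    rintro _ rfl
    rw [← has]
    noncomm_ring
  rw [← hj_eq, eq_zero_of_mul_mul_eq_self hj hc.symm, zero_mul]

theorem mul_eq_self_of_mem_span_leftSocle_mul (hA : IsLeftSelfInjective A) {I : Ideal A}
    [I.IsTwoSided] {e : A} (he : ∀ m ∈ I, m - m * e ∈ Ring.jacobson A) {x : A}
    (hx : x ∈ Submodule.span Aᵐᵒᵖ ((leftSocle A : Set A) * (I : Set A))) : x * e = x := by
  suffices ∀ c, x * c * e = x * c by simpa using this 1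
  induction hx using Submodule.span_induction with
  | mem x hx =>
    intro c
    obtain ⟨s, hs, i, hi, rfl⟩ := Set.mem_mul.mp hx
    have h0 := hA.leftSocle_mul_jacobson hs (he (i * c) (I.mul_mem_right c hi))
    rw [mul_sub, sub_eq_zero] at h0
    rw [mul_assoc s, mul_assoc s, ← h0]
  | zero => simp
  | add x y _ _ hx hy => intro c; rw [add_mul, add_mul, hx, hy]
  | smul a x _ hx => intro c; simpa [mul_assoc] using hx (a.unop * c)

theorem mem_of_forall_leftSocle_mul_mem (hA : IsLeftSelfInjective A) {I : Ideal A} [I.IsTwoSided]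
    (hJI : Ring.jacobson A ≤ I) {b : A}
    (hb : ∀ s ∈ leftSocle A, s * b ∈ Submodule.span Aᵐᵒᵖ ((leftSocle A : Set A) * (I : Set A))) :
    b ∈ I := by
  obtain ⟨e, heI, he⟩ := exists_mem_forall_sub_mul_mem (Ring.jacobson A) I
  have hJ : b - b * e ∈ Ring.jacobson A := hA.mem_jacobson_of_leftSocle_mul_eq_zero fun s hs ↦ by
    rw [mul_sub, ← mul_assoc, hA.mul_eq_self_of_mem_span_leftSocle_mul he (hb s hs), sub_self]
  simpa using add_mem (hJI hJ) (I.mul_mem_left b heI)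

theorem rightAnnihilator_leftAnnihilator_of_le_leftSocle (hA : IsLeftSelfInjective A)
    {R : Submodule Aᵐᵒᵖ A} (hR : R ≤ leftSocle A) :
    rightAnnihilator (leftAnnihilator (R : Set A) : Set A) = R := by
  have := isArtinian_quotient_of_isSemisimpleRing (Ring.jacobson A)
  have : IsArtinian A (A ⧸ leftAnnihilator (R : Set A)) :=
    isArtinian_of_surjective (A ⧸ Ring.jacobson A)
      (Submodule.factor (jacobson_le_leftAnnihilator_of_subset hR)) (Submodule.factor_surjective _)
  exact hA.rightAnnihilator_leftAnnihilator R

theorem le_of_leftAnnihilator_leftSocle_mul_le (hA : IsLeftSelfInjective A) {I K : Ideal A}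
    [K.IsTwoSided] (hK : Ring.jacobson A ≤ K)
    (h : leftAnnihilator ((leftSocle A : Set A) * (K : Set A)) ≤
      leftAnnihilator ((leftSocle A : Set A) * (I : Set A))) :
    I ≤ K := by
  refine fun b hb ↦ hA.mem_of_forall_leftSocle_mul_mem hK fun s hs ↦ ?_
  rw [← hA.rightAnnihilator_leftAnnihilator_of_le_leftSocle
    (Submodule.span_le.mpr (leftSocle_mul_subset K)), leftAnnihilator_span]
  exact fun a ha ↦ mem_leftAnnihilator.mp (h ha) _ (Set.mul_mem_mul hs hb)

theorem leftAnnihilator_leftSocle (hA : IsLeftSelfInjective A) :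
    leftAnnihilator (leftSocle A : Set A) = Ring.jacobson A := by
  refine le_antisymm ?_ (jacobson_le_leftAnnihilator_of_subset subset_rfl)
  let T := {I : Ideal A | I.IsTwoSided ∧ Ring.jacobson A ≤ I}
  have : Finite T := finite_setOf_isTwoSided_and_le (Ring.jacobson A)
  let f (I : T) : T := ⟨leftAnnihilator ((leftSocle A : Set A) * (I.1 : Set A)),
    leftAnnihilator_isTwoSided (by
      rintro a _ ⟨s, hs, i, hi, rfl⟩
      exact ⟨a * s, mul_mem_rightAnnihilator hs a, i, hi, mul_assoc a s i⟩),
    jacobson_le_leftAnnihilator_of_subset (leftSocle_mul_subset _)⟩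
  have le_of_eq (I K : T) (h : f I = f K) : I.1 ≤ K.1 :=
    have := K.2.1
    hA.le_of_leftAnnihilator_leftSocle_mul_le K.2.2 (congrArg Subtype.val h).ge
  have hf : Function.Injective f := fun I K h ↦
    Subtype.ext ((le_of_eq I K h).antisymm (le_of_eq K I h.symm))
  obtain ⟨I, hI⟩ := Finite.surjective_of_injective hf ⟨Ring.jacobson A, inferInstance, le_rfl⟩
  calc leftAnnihilator (leftSocle A : Set A)
      ≤ leftAnnihilator ((leftSocle A : Set A) * (I.1 : Set A)) :=
        leftAnnihilator_anti (leftSocle_mul_subset _)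
    _ = Ring.jacobson A := congrArg Subtype.val hI

theorem exists_ne_zero_forall_mul_eq_zero (hA : IsLeftSelfInjective A) (M : Ideal A)
    [hM : M.IsMaximal] : ∃ y, y ≠ 0 ∧ ∀ m ∈ M, m * y = 0 := by
  obtain ⟨e, heM, he⟩ := exists_mem_forall_sub_mul_mem (Ring.jacobson A) M
  have hnot : 1 - e ∉ Ring.jacobson A := fun h ↦ hM.ne_top <| (Ideal.eq_top_iff_one M).mpr <| by
    simpa using add_mem (Ring.jacobson_le_of_isMaximal M h) heM
  rw [← hA.leftAnnihilator_leftSocle, mem_leftAnnihilator] at hnot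
  push Not at hnot
  obtain ⟨s, hs, hne⟩ := hnot
  refine ⟨(1 - e) * s, hne, fun m hm ↦ ?_⟩
  rw [← mul_assoc, mul_sub, mul_one]
  exact hs _ (he m hm)

theorem exists_linearMap_apply_ne_zero (hA : IsLeftSelfInjective A) {N : Type*} [AddCommGroup N]
    [Module A N] {x : N} (hx : x ≠ 0) : ∃ f : N →ₗ[A] A, f x ≠ 0 :=
  have : Module.Injective A A := hA
  exists_linearMap_apply_ne_zero_of_forall_isMaximal
    (fun M _ ↦ hA.exists_ne_zero_forall_mul_eq_zero M) hx

theorem leftAnnihilator_rightAnnihilator (hA : IsLeftSelfInjective A) (L : Ideal A) :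
    leftAnnihilator (rightAnnihilator (L : Set A) : Set A) = L := by
  refine le_antisymm (fun x hx ↦ ?_) fun a ha ↦ mem_leftAnnihilator.mpr fun y hy ↦ hy a ha
  by_contra hxL
  obtain ⟨f, hf⟩ := hA.exists_linearMap_apply_ne_zero (x := L.mkQ x) (by simpa using hxL)
  have f_mkQ (a : A) : a * f (L.mkQ 1) = f (L.mkQ a) := by
    rw [← smul_eq_mul, ← map_smul, ← map_smul, smul_eq_mul, mul_one]
  have hmem : f (L.mkQ 1) ∈ rightAnnihilator (L : Set A) := fun a ha ↦ by
    have ha0 : L.mkQ a = 0 := (Submodule.Quotient.mk_eq_zero L).mpr ha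
    rw [f_mkQ, ha0, map_zero]
  exact hf (by rw [← f_mkQ, mem_leftAnnihilator.mp hx _ hmem])

end IsLeftSelfInjective

end LeftSocle

section Cardinality

theorem mk_le_of_span_range_eq_top {R M ι : Type u} [Semiring R] [AddCommMonoid M] [Module R M]
    {v : ι → M} (hv : Submodule.span R (Set.range v) = ⊤) : #M ≤ max ℵ₀ (#ι * #R) := by
  have hsurj : Function.Surjective fun l : List (ι × R) ↦ (l.map fun p ↦ p.2 • v p.1).sum := by
    intro x
    have hx : x ∈ Submodule.span R (Set.range v) := hv ▸ Submodule.mem_top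
    obtain ⟨c, rfl⟩ := Finsupp.mem_span_range_iff_exists_finsupp.mp hx
    refine ⟨c.support.toList.map fun i ↦ (i, c i), ?_⟩
    simp [Function.comp_def, Finsupp.sum]
  calc #M ≤ #(List (ι × R)) := mk_le_of_surjective hsurj
    _ ≤ max ℵ₀ #(ι × R) := mk_list_le_max _
    _ = max ℵ₀ (#ι * #R) := by rw [mul_def]

variable {A M : Type u} [Ring A] [AddCommGroup M] [Module A M]

theorem mk_le_of_sSup_eq_top_of_isSimpleModule {J : Ideal A} [J.IsTwoSided]
    (hJ : Module.IsTorsionBySet A M J) {s : Set (Submodule A M)} (hs : sSup s = ⊤)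
    (hsimple : ∀ m ∈ s, IsSimpleModule A m) : #M ≤ max ℵ₀ (#s * #(A ⧸ J)) := by
  have exists_span (m : s) : ∃ x, Submodule.span A {x} = m.1 := by
    have := hsimple m m.2
    have := IsSimpleModule.nontrivial A m.1
    obtain ⟨x, hx⟩ := exists_ne (0 : m.1)
    refine ⟨x, ?_⟩
    simpa [Submodule.map_span] using
      congrArg (Submodule.map m.1.subtype) (IsSimpleModule.span_singleton_eq_top A hx)
  choose v hv using exists_span
  have hspan : Submodule.span A (Set.range v) = ⊤ := by
    rw [Submodule.span_range_eq_iSup, ← hs, sSup_eq_iSup', iSup_congr hv]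
  let _ := hJ.module
  have := hJ.isScalarTower (S := A)
  refine mk_le_of_span_range_eq_top (R := A ⧸ J) (v := v) ?_
  rw [eq_top_iff, ← Submodule.restrictScalars_le (S := A), Submodule.restrictScalars_top, ← hspan,
    Submodule.span_le]
  exact Submodule.subset_span

theorem mk_linearMap_self : #(A →ₗ[A] M) = #M :=
  (LinearMap.ringLmapEquivSelf A ℕ M).toEquiv.cardinal_eq

theorem mk_linearMap_quotient_le {P : Type u} [AddCommGroup P] [Module A P] (N : Submodule A M) :
    #((M ⧸ N) →ₗ[A] P) ≤ #(M →ₗ[A] P) :=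
  mk_le_of_injective (f := (· ∘ₗ N.mkQ)) fun _ _ h ↦ Submodule.linearMap_qext _ h

namespace IsLeftSelfInjective

theorem mk_linearMap_submodule_le (hA : IsLeftSelfInjective A) (N : Submodule A M) :
    #(N →ₗ[A] A) ≤ #(M →ₗ[A] A) :=
  have : Module.Injective A A := hA
  mk_le_of_surjective (f := (· ∘ₗ N.subtype)) fun g ↦ exists_comp_eq_of_ker_le _ g (by simp)

variable [IsSemiprimaryRing A]

theorem two_power_mk_le_mk_linearMap (hA : IsLeftSelfInjective A) {ι : Type u}
    {N : ι → Submodule A M} (hN : iSupIndep N) (hne : ∀ i, N i ≠ ⊥) :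
    2 ^ #ι ≤ #(M →ₗ[A] A) := by
  classical
  have : Module.Injective A A := hA
  have exists_apply_ne_zero (i : ι) : ∃ (φ : N i →ₗ[A] A) (x : N i), φ x ≠ 0 := by
    have := (N i).nontrivial_iff_ne_bot.mpr (hne i)
    obtain ⟨x, hx⟩ := exists_ne (0 : N i)
    obtain ⟨φ, hφ⟩ := hA.exists_linearMap_apply_ne_zero hx
    exact ⟨φ, x, hφ⟩
  choose φ x hφ using exists_apply_ne_zero
  rw [← mk_set]
  refine mk_le_of_surjective (f := fun f : M →ₗ[A] A ↦ {i | f (x i) ≠ 0}) fun T ↦ ?_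
  obtain ⟨f, hf⟩ := exists_linearMap_forall_apply_eq_of_iSupIndep hN
    fun i ↦ if i ∈ T then φ i else 0
  refine ⟨f, Set.ext fun i ↦ ?_⟩
  by_cases hi : i ∈ T <;> simp [hf, hi, hφ]

theorem mk_lt_mk_linearMap_of_sSupIndep (hA : IsLeftSelfInjective A) {s : Set (Submodule A M)}
    (hs : sSupIndep s) (hsimple : ∀ m ∈ s, IsSimpleModule A m) : #s < #(M →ₗ[A] A) :=
  (cantor _).trans_le <| hA.two_power_mk_le_mk_linearMap ((sSupIndep_iff s).mp hs) fun m ↦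
    have := hsimple m m.2
    m.1.nontrivial_iff_ne_bot.mp (IsSimpleModule.nontrivial A m.1)

theorem isArtinian_of_mk_linearMap_le_aleph0 (hA : IsLeftSelfInjective A) :
    #(M →ₗ[A] A) ≤ ℵ₀ → IsArtinian A M := by
  refine IsSemiprimaryRing.induction A A M
    (P := fun M _ _ _ ↦ #(M →ₗ[A] A) ≤ ℵ₀ → IsArtinian A M) ?_ ?_
  · intro M _ _ _ _ _ _ hM
    obtain ⟨s, hs, htop, hsimple⟩ :=
      IsSemisimpleModule.exists_sSupIndep_sSup_simples_eq_top A M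
    have : s.Finite := lt_aleph0_iff_set_finite.mp
      ((hA.mk_lt_mk_linearMap_of_sSupIndep hs hsimple).trans_le hM)
    refine (IsSemisimpleModule.finite_tfae.out 4 2).mp ?_
    exact ⟨s, this, hs, htop, hsimple⟩
  · intro M _ _ _ _ N ihN ihQ hM
    exact (isArtinian_iff_submodule_quotient N).mpr
      ⟨ihN ((hA.mk_linearMap_submodule_le N).trans hM),
        ihQ ((mk_linearMap_quotient_le N).trans hM)⟩

theorem mk_lt_of_mk_linearMap_le (hA : IsLeftSelfInjective A) {κ : Cardinal.{u}} (hκ : ℵ₀ < κ)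
    (hB : #(A ⧸ Ring.jacobson A) < κ) : #(M →ₗ[A] A) ≤ κ → #M < κ := by
  refine IsSemiprimaryRing.induction A A M
    (P := fun M _ _ _ ↦ #(M →ₗ[A] A) ≤ κ → #M < κ) ?_ ?_
  · intro M _ _ _ _ _ hJ hM
    obtain ⟨s, hs, htop, hsimple⟩ :=
      IsSemisimpleModule.exists_sSupIndep_sSup_simples_eq_top A M
    have hsκ : #s < κ := (hA.mk_lt_mk_linearMap_of_sSupIndep hs hsimple).trans_le hM
    exact (mk_le_of_sSup_eq_top_of_isSimpleModule hJ htop hsimple).trans_lt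
      (max_lt hκ (mul_lt_of_lt hκ.le hsκ hB))
  · intro M _ _ _ _ N ihN ihQ hM
    calc #M = #(M ⧸ N) * #N := by
          rw [mul_def]
          exact mk_congr (AddSubgroup.addGroupEquivQuotientProdAddSubgroup (s := N.toAddSubgroup))
      _ < κ := mul_lt_of_lt hκ.le (ihQ ((mk_linearMap_quotient_le N).trans hM))
        (ihN ((hA.mk_linearMap_submodule_le N).trans hM))

theorem mk_le_max_aleph0_mk_quotient_jacobson (hA : IsLeftSelfInjective A) :
    #A ≤ max ℵ₀ #(A ⧸ Ring.jacobson A) := by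
  by_contra! h
  obtain ⟨hA₀, hAJ⟩ := max_lt_iff.mp h
  exact (hA.mk_lt_of_mk_linearMap_le hA₀ hAJ mk_linearMap_self.le).false

end IsLeftSelfInjective

end Cardinality

section QuasiFrobenius

namespace IsLeftSelfInjective

variable {A : Type*} [Ring A]

theorem exists_mul_eq_of_span_singleton [IsSemiprimaryRing A] (hA : IsLeftSelfInjective A) {a : A}
    (g : Submodule.span Aᵐᵒᵖ {a} →ₗ[Aᵐᵒᵖ] A) : ∃ c, ∀ x, c * x.1 = g x := by
  let a' : Submodule.span Aᵐᵒᵖ {a} := ⟨a, Submodule.mem_span_singleton_self a⟩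
  have hga : g a' ∈ Ideal.span {a} := by
    rw [← hA.leftAnnihilator_rightAnnihilator (Ideal.span {a}), mem_leftAnnihilator]
    intro y hy
    have hay : MulOpposite.op y • a' = 0 := Subtype.ext (hy a (Ideal.mem_span_singleton_self a))
    calc g a' * y = g (MulOpposite.op y • a') := (map_smul g (MulOpposite.op y) a').symm
      _ = 0 := by rw [hay, map_zero]
  obtain ⟨c, hc⟩ := Ideal.mem_span_singleton'.mp hga
  refine ⟨c, fun x ↦ ?_⟩
  obtain ⟨b, hb⟩ := Submodule.mem_span_singleton.mp x.2
  obtain rfl : b • a' = x := Subtype.ext hb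
  rw [map_smul, ← hc]
  exact (mul_assoc c a b.unop).symm

variable [IsArtinianRing A]

theorem leftAnnihilator_strictAnti (hA : IsLeftSelfInjective A) :
    StrictAnti fun R : Submodule Aᵐᵒᵖ A ↦ leftAnnihilator (R : Set A) :=
  Antitone.strictAnti_of_injective (fun _ _ ↦ leftAnnihilator_anti) fun R R' h ↦ by
    rw [← hA.rightAnnihilator_leftAnnihilator R, ← hA.rightAnnihilator_leftAnnihilator R']
    exact congrArg (fun I : Ideal A ↦ rightAnnihilator (I : Set A)) h

theorem leftAnnihilator_inf (hA : IsLeftSelfInjective A) (R R' : Submodule Aᵐᵒᵖ A) :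
    leftAnnihilator ((R ⊓ R' : Submodule Aᵐᵒᵖ A) : Set A) =
      leftAnnihilator (R : Set A) ⊔ leftAnnihilator (R' : Set A) := by
  rw [← hA.leftAnnihilator_rightAnnihilator (_ ⊔ _), rightAnnihilator_sup,
    hA.rightAnnihilator_leftAnnihilator, hA.rightAnnihilator_leftAnnihilator]

theorem exists_forall_mul_eq_and_forall_mul_eq (hA : IsLeftSelfInjective A)
    {R R' : Submodule Aᵐᵒᵖ A} {c c' : A} (h : ∀ x ∈ R ⊓ R', c * x = c' * x) :
    ∃ d, (∀ x ∈ R, d * x = c * x) ∧ ∀ x ∈ R', d * x = c' * x := by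
  have hmem : c - c' ∈ leftAnnihilator (R : Set A) ⊔ leftAnnihilator (R' : Set A) := by
    rw [← hA.leftAnnihilator_inf, mem_leftAnnihilator]
    exact fun x hx ↦ by rw [sub_mul, h x hx, sub_self]
  obtain ⟨l, hl, l', hl', hsum⟩ := Submodule.mem_sup.mp hmem
  have hd : c - l = c' + l' := by rw [sub_eq_iff_eq_add, add_assoc, add_comm l', hsum]; abel
  refine ⟨c - l, fun x hx ↦ ?_, fun x hx ↦ ?_⟩
  · rw [sub_mul, mem_leftAnnihilator.mp hl x hx, sub_zero]
  · rw [hd, add_mul, mem_leftAnnihilator.mp hl' x hx, add_zero]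

theorem exists_mul_eq_of_fg (hA : IsLeftSelfInjective A) {R : Submodule Aᵐᵒᵖ A} (hR : R.FG)
    (g : R →ₗ[Aᵐᵒᵖ] A) : ∃ c, ∀ x, c * x.1 = g x := by
  induction R, hR using Submodule.fg_induction with
  | singleton a => exact hA.exists_mul_eq_of_span_singleton g
  | sup R R' _ _ ihR ihR' =>
    obtain ⟨c, hc⟩ := ihR (g ∘ₗ Submodule.inclusion le_sup_left)
    obtain ⟨c', hc'⟩ := ihR' (g ∘ₗ Submodule.inclusion le_sup_right)
    obtain ⟨d, hd, hd'⟩ := hA.exists_forall_mul_eq_and_forall_mul_eq (c := c) (c' := c')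
      fun x (hx : x ∈ R ⊓ R') ↦ (hc ⟨x, hx.1⟩).trans (hc' ⟨x, hx.2⟩).symm
    refine ⟨d, fun ⟨x, hx⟩ ↦ ?_⟩
    obtain ⟨y, hy, z, hz, rfl⟩ := Submodule.mem_sup.mp hx
    calc d * (y + z) = c * y + c' * z := by rw [mul_add, hd y hy, hd' z hz]
      _ = g ⟨y, Submodule.mem_sup_left hy⟩ + g ⟨z, Submodule.mem_sup_right hz⟩ :=
        congrArg₂ (· + ·) (hc ⟨y, hy⟩) (hc' ⟨z, hz⟩)
      _ = g ⟨y + z, hx⟩ := (map_add g _ _).symm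

theorem isQuasiFrobenius (hA : IsLeftSelfInjective A) : IsQuasiFrobenius A where
  left_artinian := inferInstance
  right_artinian := hA.leftAnnihilator_strictAnti.wellFoundedLT
  left_selfInjective := hA
  right_selfInjective := by
    have : IsNoetherian Aᵐᵒᵖ A :=
      isNoetherian_iff'.mpr hA.leftAnnihilator_strictAnti.wellFoundedGT
    refine Module.Baer.injective fun I g ↦ ?_
    let op : A →ₗ[Aᵐᵒᵖ] Aᵐᵒᵖ := ⟨⟨MulOpposite.op, fun _ _ ↦ rfl⟩, fun _ _ ↦ rfl⟩
    obtain ⟨c, hc⟩ := hA.exists_mul_eq_of_fg (IsNoetherian.noetherian (Submodule.comap op I))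
      (g ∘ₗ op.restrict fun _ h ↦ h)
    exact ⟨LinearMap.toSpanSingleton Aᵐᵒᵖ A c, fun x hx ↦ hc ⟨x.unop, hx⟩⟩

end IsLeftSelfInjective

theorem IsLeftSelfInjective.isQuasiFrobenius_of_mk_le_aleph0 {A : Type u} [Ring A]
    [IsSemiprimaryRing A] (hA : IsLeftSelfInjective A) (h : #A ≤ ℵ₀) : IsQuasiFrobenius A :=
  have : IsArtinianRing A := hA.isArtinian_of_mk_linearMap_le_aleph0 <|
    mk_linearMap_self.trans_le h
  hA.isQuasiFrobenius

end QuasiFrobenius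

theorem mainTheorem3 (A : Type*) [Ring A] [IsSemiprimaryRing A]
    (hA : IsLeftSelfInjective A) :
    (Cardinal.mk (A ⧸ Ring.jacobson A) ≤ Cardinal.aleph0 → IsQuasiFrobenius A) ∧
      (Cardinal.mk (A ⧸ Ring.jacobson A) < Cardinal.mk A → IsQuasiFrobenius A) := by
  have bound := hA.mk_le_max_aleph0_mk_quotient_jacobson
  refine ⟨fun h ↦ ?_, fun h ↦ ?_⟩
  · exact hA.isQuasiFrobenius_of_mk_le_aleph0 (bound.trans (max_le le_rfl h))
  · exact hA.isQuasiFrobenius_of_mk_le_aleph0 ((le_max_iff.mp bound).resolve_right h.not_ge)
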